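/- Let $\mathbb{F}_q$ be a finite field with $q$ elements, $A=\mathbb{F}_q[\theta]$, $K=\mathbb{F}_q(\theta)$, $K_\infty=\mathbb{F}_q((1/\theta))$ and $\mathbb{C}_\infty$ the completion of an algebraic closure of $K_\infty$. For $d\ge 0$ and $s\geq 1$ let $S_d(s)=\sum_a a^{-s}\in K$, the sum over the monic $a\in A$ of degree $d$, and for positive integers $s_1,\dots,s_m$ let $$\zeta_A(s_1,\dots,s_m)=\sum_{d_1>\cdots>d_m\ge 0}S_{d_1}(s_1)\cdots S_{d_m}(s_m)\in K_\infty .$$ For $i\ge 1$ put $[i]=\theta^{q^i}-\theta$ and $L_i=[i][i-1]\cdots[1]$. Let $$\tilde\pi=(-\theta)^{\frac{q}{q-1}}\prod_{i=1}^{\infty}\Bigl(1-\frac{\theta}{\theta^{q^i}}\Bigr)^{-1}\in\mathbb{C}_\infty$$ be the fundamental period of the Carlitz module, where $(-\theta)^{q/(q-1)}=\rho^q$ for an arbitrary fixed choice of a root $\rho\in\mathbb{C}_\infty$ of $\rho^{q-1}=-\theta$. Theorem. For all integers $r>1$ and $n\ge 1$, $$\zeta_A\bigl(q^n-1,(q-1)q^n,\dots,(q-1)q^{n+r-2}\bigr)=\zeta_A(q^n-1)\,\zeta_A\bigl(q-1,(q-1)q,\dots,(q-1)q^{r-2}\bigr)^{q^n}-\zeta_A\bigl(q^{n+1}-1,(q-1)q^{n+1},\dots,(q-1)q^{n+r-2}\bigr),$$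 where the multizeta values have, in this order, depth $r$, $1$, $r-1$ and $r-1$. Moreover, $$\zeta_A\bigl(q^n-1,(q-1)q^n,\dots,(q-1)q^{n+r-2}\bigr)=\frac{(-1)^{n+r-1}[n+r-2][n+r-3]\cdots[n]}{[1]^{q^{n+r-2}}[2]^{q^{n+r-3}}\cdots[r-1]^{q^n}\,L_{n+r-1}}\,\tilde\pi^{\,q^{n+r-1}-1}=\frac{[n+r-2][n+r-3]\cdots[n]}{[1]^{q^{n+r-2}}[2]^{q^{n+r-3}}\cdots[r-1]^{q^n}}\,\zeta_A\bigl(q^{n+r-1}-1\bigr).$$ In particular this value is Eulerian: it is an element of $K$ times $\tilde\pi^{\,w}$, where $w$ is its weight, the sum of its arguments. -/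

import Mathlib

open Polynomial
open scoped WithZero

noncomputable section

namespace CarlitzMZV

/-- The completion `K_∞ = F((1/θ))` of `K = F(θ)` (that is, `RatFunc F`, with `θ = RatFunc.X`) at the
infinite place. -/
abbrev KInf (F : Type*) [Field F] : Type _ :=
  @RatFunc.CompletionAtInfty F _ (Classical.decEq _)

section Completion

variable (F : Type*) [Field F]

instance instCompleteSpaceKInf : CompleteSpace (KInf F) :=
  letI : DecidableEq (RatFunc F) := Classical.decEq _
  letI : Valued (RatFunc F) ℤᵐ⁰ := RatFunc.inftyValued F
  inferInstanceAs (CompleteSpace (UniformSpace.Completion (RatFunc F)))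

theorem valued_algebraMap (x : RatFunc F) :
    Valued.v (algebraMap (RatFunc F) (KInf F) x) =
      @RatFunc.inftyValuationDef F _ (Classical.decEq _) x :=
  letI : DecidableEq (RatFunc F) := Classical.decEq _
  letI : Valued (RatFunc F) ℤᵐ⁰ := RatFunc.inftyValued F
  Valued.valuedCompletion_apply x

theorem valued_theta :
    Valued.v (algebraMap (RatFunc F) (KInf F) RatFunc.X) = WithZero.exp (1 : ℤ) := by
  rw [valued_algebraMap, RatFunc.inftyValuationDef, if_neg RatFunc.X_ne_zero, RatFunc.intDegree_X]

variable [Fintype F]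

/-- The valuation of `K_∞` has rank one, normalized so that `|θ| = q`. -/
instance instRankOneKInf : (Valued.v : Valuation (KInf F) ℤᵐ⁰).RankOne where
  hom' := (WithZeroMulInt.toNNReal (e := Fintype.card F) (by simp)).comp
    MonoidWithZeroHom.ValueGroup₀.embedding
  strictMono' := (WithZeroMulInt.toNNReal_strictMono
    (by exact_mod_cast Fintype.one_lt_card)).comp
      MonoidWithZeroHom.ValueGroup₀.embedding_strictMono
  exists_val_nontrivial := ⟨algebraMap (RatFunc F) (KInf F) RatFunc.X, by
    rw [valued_theta]; simp⟩

/-- The absolute value of `K_∞`, as a norm inducing the topology of `K_∞`. -/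
instance instNormedFieldKInf : NontriviallyNormedField (KInf F) :=
  Valued.toNontriviallyNormedField (KInf F) ℤᵐ⁰

instance instUltrametricKInf : IsUltrametricDist (KInf F) :=
  Valued.instIsUltrametricDist _ _

/-- The absolute value of a polynomial `a ≠ 0` is `q ^ deg a`. -/
theorem norm_polynomial {a : F[X]} (ha : a ≠ 0) :
    ‖algebraMap (RatFunc F) (KInf F) (algebraMap F[X] (RatFunc F) a)‖
      = (Fintype.card F : ℝ) ^ a.natDegree := by
  let _ : DecidableEq (RatFunc F) := Classical.decEq _
  have h : Valued.v (algebraMap (RatFunc F) (KInf F) (algebraMap F[X] (RatFunc F) a))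
      = WithZero.exp (a.natDegree : ℤ) := by
    rw [valued_algebraMap]
    exact RatFunc.inftyValuation.polynomial F ha
  rw [Valued.toNormedField.norm_def]
  change ((WithZeroMulInt.toNNReal (e := Fintype.card F) (by simp)
    (MonoidWithZeroHom.ValueGroup₀.embedding (Valued.v.restrict
      (algebraMap (RatFunc F) (KInf F) (algebraMap F[X] (RatFunc F) a)))) : NNReal) : ℝ) = _
  rw [Valuation.embedding_restrict, h]
  rw [WithZeroMulInt.toNNReal_neg_apply _ (by simp)]
  simp [WithZero.exp]

/-- The absolute value of the algebraic closure of `K_∞`: the unique extension of that of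
`K_∞`. -/
instance instNormedFieldAlgClosure : NormedField (AlgebraicClosure (KInf F)) :=
  spectralNorm.normedField (KInf F) (AlgebraicClosure (KInf F))

instance instNormedAlgebraAlgClosure : NormedAlgebra (KInf F) (AlgebraicClosure (KInf F)) :=
  spectralNorm.normedAlgebra (KInf F) (AlgebraicClosure (KInf F))

/-- The field `ℂ_∞`: the completion of an algebraic closure of `K_∞`. -/
abbrev CInf : Type _ := UniformSpace.Completion (AlgebraicClosure (KInf F))

end Completion

section Zeta

variable (F : Type*) [Field F] [Fintype F]

theorem finite_monicsOfDegree (d : ℕ) : {a : F[X] | a.Monic ∧ a.natDegree = d}.Finite := by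
  have hfin : ((Polynomial.degreeLT F (d + 1) : Submodule F F[X]) : Set F[X]).Finite :=
    Set.finite_coe_iff.mp (Finite.of_equiv _ (Polynomial.degreeLTEquiv F (d + 1)).symm.toEquiv)
  refine hfin.subset fun a ha => ?_
  rw [SetLike.mem_coe, Polynomial.mem_degreeLT]
  refine lt_of_le_of_lt Polynomial.degree_le_natDegree ?_
  rw [ha.2]
  exact_mod_cast Nat.lt_succ_self d

/-- `A_{d+}`: the monic polynomials of degree `d` over `F`. -/
def monicsOfDegree (d : ℕ) : Finset F[X] := (finite_monicsOfDegree F d).toFinset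

theorem mem_monicsOfDegree {d : ℕ} {a : F[X]} :
    a ∈ monicsOfDegree F d ↔ a.Monic ∧ a.natDegree = d := by
  simp [monicsOfDegree]

/-- The power sum `S_d(s) = ∑ 1 / a ^ s ∈ K`, over the monic polynomials `a` of degree `d`. -/
def powerSum (d s : ℕ) : RatFunc F :=
  ∑ a ∈ monicsOfDegree F d, 1 / (algebraMap F[X] (RatFunc F) a) ^ s

/-- The term `S_{d_1}(s_1) ⋯ S_{d_r}(s_r)`, as an element of `K_∞`. -/
def zetaTerm {r : ℕ} (s d : Fin r → ℕ) : KInf F :=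
  ∏ i, algebraMap (RatFunc F) (KInf F) (powerSum F (d i) (s i))

/-- The multizeta value `ζ_A(s_1, …, s_r) ∈ K_∞`: the sum of `S_{d_1}(s_1) ⋯ S_{d_r}(s_r)` over all
integers `d_1 > ⋯ > d_r ≥ 0`. The sum converges if all `s_i` are positive, see `summable_zetaTerm`
below. The case `r = 1` is the Carlitz zeta value. -/
def zeta {r : ℕ} (s : Fin r → ℕ) : KInf F :=
  ∑' d : {d : Fin r → ℕ // StrictAnti d}, zetaTerm F s d

theorem norm_powerSum_le (d s : ℕ) (hs : 0 < s) :
    ‖algebraMap (RatFunc F) (KInf F) (powerSum F d s)‖ ≤ ((Fintype.card F : ℝ)⁻¹) ^ d := by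
  have hq : (1 : ℝ) ≤ Fintype.card F := by exact_mod_cast Fintype.card_pos
  rw [powerSum, map_sum]
  refine IsUltrametricDist.norm_sum_le_of_forall_le_of_nonneg (by positivity) fun a ha => ?_
  obtain ⟨hm, hd⟩ := (mem_monicsOfDegree F).1 ha
  rw [map_div₀, map_one, map_pow, norm_div, norm_one, norm_pow, norm_polynomial F hm.ne_zero, hd,
    one_div, inv_pow]
  gcongr
  exact le_self_pow₀ (one_le_pow₀ hq) hs.ne'

/-- The series defining a multizeta value converges. -/
theorem summable_zetaTerm {r : ℕ} (s : Fin r → ℕ) (hs : ∀ i, 0 < s i) :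
    Summable fun d : {d : Fin r → ℕ // StrictAnti d} => zetaTerm F s d := by
  have hq : (1 : ℝ) < Fintype.card F := by exact_mod_cast Fintype.one_lt_card
  have : NonarchimedeanAddGroup (KInf F) := inferInstance
  apply NonarchimedeanAddGroup.summable_of_tendsto_cofinite_zero
  have hsum : Filter.Tendsto (fun d : Fin r → ℕ => ∑ i, d i) Filter.cofinite Filter.atTop := by
    refine Filter.tendsto_atTop.2 fun b => ?_
    rw [Filter.eventually_cofinite]
    refine (Set.finite_Iic (fun _ : Fin r => b)).subset fun d hd i => ?_
    have h1 : ¬ b ≤ ∑ i, d i := hd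
    have h2 : d i ≤ ∑ i, d i := Finset.single_le_sum (f := d) (by simp) (Finset.mem_univ i)
    change d i ≤ b
    omega
  have h := (tendsto_pow_atTop_nhds_zero_of_lt_one (r := (Fintype.card F : ℝ)⁻¹) (by positivity)
    (inv_lt_one_of_one_lt₀ hq)).comp (hsum.comp
      (Subtype.val_injective (p := fun d : Fin r → ℕ => StrictAnti d)).tendsto_cofinite)
  refine squeeze_zero_norm (fun d => ?_) h
  rw [zetaTerm, norm_prod]
  simp only [Function.comp_apply, ← Finset.prod_pow_eq_pow_sum]
  exact Finset.prod_le_prod (fun _ _ => norm_nonneg _) fun i _ => norm_powerSum_le F _ _ (hs i)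

end Zeta

section Period

variable (F : Type*) [Field F] [Fintype F]

/-- `[n] = θ ^ (q ^ n) - θ`. -/
def bracket (n : ℕ) : RatFunc F := RatFunc.X ^ Fintype.card F ^ n - RatFunc.X

/-- `L_n = [n] [n - 1] ⋯ [1]`. -/
def carlitzL (n : ℕ) : RatFunc F := ∏ i ∈ Finset.Icc 1 n, bracket F i

/-- The inclusion of `K` in `ℂ_∞`. -/
def toCInf : RatFunc F →+* CInf F :=
  (algebraMap (KInf F) (CInf F)).comp (algebraMap (RatFunc F) (KInf F))

/-- The factor `(1 - θ / θ ^ (q ^ i))⁻¹` of the product for the Carlitz period. -/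
def periodFactor (i : ℕ) : KInf F :=
  algebraMap (RatFunc F) (KInf F) (1 - RatFunc.X / RatFunc.X ^ Fintype.card F ^ i)⁻¹

/-- The product `∏_{i ≥ 1} (1 - θ / θ ^ (q ^ i))⁻¹`, which converges in `K_∞`. -/
def periodProduct : KInf F := ∏' i : ℕ, periodFactor F (i + 1)

/-- The fundamental period `π̃ = (-θ) ^ (q / (q - 1)) ∏_{i ≥ 1} (1 - θ / θ ^ (q ^ i))⁻¹` of the
Carlitz module, for a choice `ρ` of the root `(-θ) ^ (1 / (q - 1))`. -/
def carlitzPeriod (ρ : CInf F) : CInf F :=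
  ρ ^ Fintype.card F * algebraMap (KInf F) (CInf F) (periodProduct F)

theorem multipliable_periodFactor : Multipliable fun i : ℕ => periodFactor F (i + 1) := by
  have hq : (1 : ℝ) < Fintype.card F := by exact_mod_cast Fintype.one_lt_card
  have hq2 : 1 < Fintype.card F := Fintype.one_lt_card
  have hθ : ‖algebraMap (RatFunc F) (KInf F) RatFunc.X‖ = Fintype.card F := by
    rw [← RatFunc.algebraMap_X, norm_polynomial F Polynomial.X_ne_zero]
    simp
  have hx (i : ℕ) : ‖algebraMap (RatFunc F) (KInf F)
      (RatFunc.X / RatFunc.X ^ Fintype.card F ^ (i + 1))‖ ≤ ((Fintype.card F : ℝ)⁻¹) ^ (i + 1) := by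
    have h1 : i + 1 + 1 ≤ Fintype.card F ^ (i + 1) := Nat.lt_pow_self hq2
    rw [map_div₀, map_pow, norm_div, norm_pow, hθ, inv_pow, div_le_iff₀ (by positivity),
      ← div_eq_inv_mul, le_div_iff₀ (by positivity), ← pow_succ']
    exact pow_le_pow_right₀ hq.le h1
  have hlt (i : ℕ) : ‖algebraMap (RatFunc F) (KInf F)
      (RatFunc.X / RatFunc.X ^ Fintype.card F ^ (i + 1))‖ < 1 :=
    (hx i).trans_lt (pow_lt_one₀ (by positivity) (inv_lt_one_of_one_lt₀ hq) (by omega))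
  have hone (y : KInf F) (hy : ‖y‖ < 1) : ‖1 - y‖ = 1 := by
    have h := IsUltrametricDist.norm_add_eq_max_of_norm_ne_norm (x := (1 : KInf F)) (y := -y)
      (by rw [norm_neg, norm_one]; exact hy.ne')
    rw [sub_eq_add_neg, h, norm_neg, norm_one, max_eq_left hy.le]
  have hg (i : ℕ) : ‖periodFactor F (i + 1) - 1‖ ≤ ((Fintype.card F : ℝ)⁻¹) ^ (i + 1) := by
    refine le_trans (le_of_eq ?_) (hx i)
    rw [periodFactor, map_inv₀, map_sub, map_one]
    set y := algebraMap (RatFunc F) (KInf F) (RatFunc.X / RatFunc.X ^ Fintype.card F ^ (i + 1))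
    have h1 := hone y (hlt i)
    have h2 : 1 - y ≠ 0 := norm_ne_zero_iff.1 (by rw [h1]; exact one_ne_zero)
    have h3 : (1 - y)⁻¹ - 1 = y / (1 - y) := by field_simp; ring
    rw [h3, norm_div, h1, div_one]
  have hs : Summable fun i => ‖periodFactor F (i + 1) - 1‖ :=
    Summable.of_nonneg_of_le (fun _ => norm_nonneg _) hg
      ((summable_nat_add_iff 1).2
        (summable_geometric_of_lt_one (by positivity) (inv_lt_one_of_one_lt₀ hq)))
  simpa using multipliable_one_add_of_summable hs

/-- `ζ_A(s)` is Eulerian with respect to the period `ϖ`: it is `ϖ ^ w` times an element of `K`, where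
`w` is the weight `s_1 + ⋯ + s_r`. -/
def IsEulerian (ϖ : CInf F) {r : ℕ} (s : Fin r → ℕ) : Prop :=
  ∃ c : RatFunc F, algebraMap (KInf F) (CInf F) (zeta F s) = toCInf F c * ϖ ^ (∑ i, s i)

end Period

/-- The `r`-tuple `(q ^ n - 1, (q - 1) q ^ n, (q - 1) q ^ (n + 1), …, (q - 1) q ^ (n + r - 2))`. -/
def eulerianIndex (q n r : ℕ) (i : Fin r) : ℕ :=
  if (i : ℕ) = 0 then q ^ n - 1 else (q - 1) * q ^ (n + i - 1)

end CarlitzMZV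

end

/-! Write `ℓ_d = (-1)^d L_d`. Everything rests on two closed forms, `S_d(q^(j+1) - 1) = ℓ_(d+j) /
(ℓ_j ℓ_d^(q^(j+1)))` and `∑_{e ≤ d} S_e(q^j - 1) = ℓ_(d+j) / (ℓ_j ℓ_d^(q^j))` for `j ≥ 1`. The first
comes from Lagrange interpolation at the monic polynomials of degree `d`, whose nodal polynomial is
`e_d - D_d` with `e_d` the Carlitz polynomial; the second follows by induction on `d`.

Recursion: the closed forms give `S_d((q-1)q^n) ∑_{e ≤ d} S_e(q^n - 1) = S_d(q^(n+1) - 1)`. In the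
product of `ζ(q^n - 1)` with the `q^n`-th power, the pairs of leading indices `e > f` yield the
depth `r` value, and the pairs `e ≤ f` merge into the other value of depth `r - 1`.

Value: by induction on depth, each term of the outermost sum is a constant times a shifted depth one
term (`powerSum_mul_truncZeta_tail`), so the whole value is that constant times `ζ(q^(n+r-1) - 1)`.
Carlitz's evaluation of the latter is the limit of the second closed form, since `ℓ_d` is a power of
`θ`, up to sign, divided by a partial product of the period. -/

noncomputable section

namespace CarlitzMZV

/-! ### Frobenius, Carlitz factorials and brackets -/

section PowerSums

variable (F : Type*) [Field F] [Fintype F]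

/-- The `F`-linear endomorphism `x ↦ x ^ (q ^ n)` of a commutative `F`-algebra. -/
def frob (R : Type*) [CommRing R] [Algebra F R] (n : ℕ) : R →ₐ[F] R :=
  FiniteField.frobeniusAlgHom F R ^ n

variable {F} in
theorem frob_apply {R : Type*} [CommRing R] [Algebra F R] (n : ℕ) (x : R) :
    frob F R n x = x ^ Fintype.card F ^ n := by
  rw [frob, AlgHom.coe_pow, FiniteField.coe_frobeniusAlgHom, pow_iterate]

theorem sub_pow_card_pow {R : Type*} [CommRing R] [Algebra F R] (x y : R) (n : ℕ) :
    (x - y) ^ Fintype.card F ^ n = x ^ Fintype.card F ^ n - y ^ Fintype.card F ^ n := by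
  simp only [← frob_apply, map_sub]

theorem sub_pow_card {R : Type*} [CommRing R] [Algebra F R] (x y : R) :
    (x - y) ^ Fintype.card F = x ^ Fintype.card F - y ^ Fintype.card F := by
  simpa using sub_pow_card_pow F x y 1

theorem add_pow_card {R : Type*} [CommRing R] [Algebra F R] (x y : R) :
    (x + y) ^ Fintype.card F = x ^ Fintype.card F + y ^ Fintype.card F := by
  simpa [frob_apply] using map_add (frob F R 1) x y

theorem neg_pow_card_pow {R : Type*} [CommRing R] [Algebra F R] (x : R) (n : ℕ) :
    (-x) ^ Fintype.card F ^ n = -x ^ Fintype.card F ^ n := by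
  simp only [← frob_apply, map_neg]

/-- `D_d`, the product of the monic polynomials of degree `d`. -/
def carlitzD : ℕ → RatFunc F
  | 0 => 1
  | d + 1 => bracket F (d + 1) * carlitzD d ^ Fintype.card F

/-- `ℓ_d = (-1) ^ d L_d`. -/
def signedL : ℕ → RatFunc F
  | 0 => 1
  | d + 1 => -bracket F (d + 1) * signedL d

theorem signedL_eq (d : ℕ) : signedL F d = (-1) ^ d * carlitzL F d := by
  induction d with
  | zero => simp [signedL, carlitzL]
  | succ d ih =>
    rw [signedL, ih, carlitzL, carlitzL, Finset.prod_Icc_succ_top (by omega)]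
    ring

theorem X_pow_card_pow_injective :
    Function.Injective fun n : ℕ => (RatFunc.X : RatFunc F) ^ Fintype.card F ^ n := by
  intro m n h
  simp only [← RatFunc.algebraMap_X, ← map_pow] at h
  have h' := congrArg natDegree (RatFunc.algebraMap_injective F h)
  rw [natDegree_X_pow, natDegree_X_pow] at h'
  exact Nat.pow_right_injective Fintype.one_lt_card h'

theorem bracket_ne_zero {d : ℕ} (hd : 0 < d) : bracket F d ≠ 0 := by
  intro h
  have := X_pow_card_pow_injective F (a₁ := d) (a₂ := 0) (by simpa using sub_eq_zero.1 h)
  omega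

theorem carlitzD_ne_zero (d : ℕ) : carlitzD F d ≠ 0 := by
  induction d with
  | zero => exact one_ne_zero
  | succ d ih => exact mul_ne_zero (bracket_ne_zero F d.succ_pos) (pow_ne_zero _ ih)

theorem signedL_ne_zero (d : ℕ) : signedL F d ≠ 0 := by
  induction d with
  | zero => exact one_ne_zero
  | succ d ih => exact mul_ne_zero (neg_ne_zero.2 (bracket_ne_zero F d.succ_pos)) ih

/-- Frobenius turns `θ^(q^d) - θ` into `θ^(q^(d+j)) - θ^(q^j)`. This relation drives both the
functional equation of `e_d` and the summation of `S_e(q^j - 1)`. -/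
theorem bracket_pow (d j : ℕ) :
    bracket F d ^ Fintype.card F ^ j = bracket F (d + j) - bracket F j := by
  rw [bracket, bracket, bracket, sub_pow_card_pow, ← pow_mul, ← pow_add]
  ring

/-! ### Carlitz polynomials -/

/-- The Carlitz polynomial `e_d`, the product of the `X - a` over the `a` of degree less than `d`,
through its recursion. -/
def carlitzE : ℕ → (RatFunc F)[X]
  | 0 => X
  | d + 1 => carlitzE d ^ Fintype.card F - C (carlitzD F d ^ (Fintype.card F - 1)) * carlitzE d

theorem eval_carlitzE_succ (d : ℕ) (x : RatFunc F) :
    (carlitzE F (d + 1)).eval x = (carlitzE F d).eval x ^ Fintype.card F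
      - carlitzD F d ^ (Fintype.card F - 1) * (carlitzE F d).eval x := by
  simp [carlitzE]

theorem eval_carlitzE_add (d : ℕ) (x y : RatFunc F) :
    (carlitzE F d).eval (x + y) = (carlitzE F d).eval x + (carlitzE F d).eval y := by
  induction d with
  | zero => simp [carlitzE]
  | succ d ih => rw [eval_carlitzE_succ, eval_carlitzE_succ, eval_carlitzE_succ, ih, add_pow_card]; ring

theorem eval_carlitzE_smul (d : ℕ) (c : F) (x : RatFunc F) :
    (carlitzE F d).eval (c • x) = c • (carlitzE F d).eval x := by
  induction d with
  | zero => simp [carlitzE]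
  | succ d ih =>
    rw [eval_carlitzE_succ, eval_carlitzE_succ, ih, _root_.smul_pow, FiniteField.pow_card, smul_sub,
      mul_smul_comm]

/-- Substituting the induction hypothesis into the recursion for `e_(d+2)` leaves a multiple of the
recursion for `e_(d+1)(x)^q`, thanks to `[d+1]^q = [d+2] - [1]`. With `x = θ^d` it computes
`e_(d+1)(θ^(d+1))`. -/
theorem eval_carlitzE_X_mul (d : ℕ) (x : RatFunc F) :
    (carlitzE F (d + 1)).eval (RatFunc.X * x) = RatFunc.X * (carlitzE F (d + 1)).eval x
      + bracket F (d + 1) * (carlitzE F d).eval x ^ Fintype.card F := by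
  have hq : Fintype.card F = Fintype.card F - 1 + 1 := by have := Fintype.card_pos (α := F); omega
  induction d with
  | zero =>
    simp only [eval_carlitzE_succ, carlitzE.eq_1, carlitzD, eval_X, bracket, zero_add, pow_one, one_pow]
    ring
  | succ d ih =>
    have hb : bracket F (d + 1) ^ Fintype.card F = bracket F (d + 2) - bracket F 1 := by
      simpa using bracket_pow F (d + 1) 1
    have h1 : bracket F 1 = RatFunc.X ^ Fintype.card F - RatFunc.X := by simp [bracket]
    have hD : bracket F (d + 1) * carlitzD F (d + 1) ^ (Fintype.card F - 1)
        = bracket F (d + 1) ^ Fintype.card F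
          * (carlitzD F d ^ (Fintype.card F - 1)) ^ Fintype.card F := by
      rw [carlitzD, mul_pow, ← mul_assoc, ← pow_succ', ← hq, ← pow_mul, ← pow_mul, mul_comm (Fintype.card F)]
    have hE : (carlitzE F (d + 1)).eval x ^ Fintype.card F
        = ((carlitzE F d).eval x ^ Fintype.card F) ^ Fintype.card F
          - (carlitzD F d ^ (Fintype.card F - 1)) ^ Fintype.card F
            * (carlitzE F d).eval x ^ Fintype.card F := by
      rw [eval_carlitzE_succ, sub_pow_card, mul_pow]
    rw [eval_carlitzE_succ F (d + 1), ih, eval_carlitzE_succ F (d + 1), add_pow_card, mul_pow,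
      mul_pow]
    rw [hb, h1] at *
    linear_combination (-(carlitzE F d).eval x ^ Fintype.card F) * hD
      - (bracket F (d + 2) - (RatFunc.X ^ Fintype.card F - RatFunc.X)) * hE

theorem eval_carlitzE_X_pow (d : ℕ) :
    (carlitzE F d).eval (RatFunc.X ^ d) = carlitzD F d := by
  induction d with
  | zero => simp [carlitzE, carlitzD]
  | succ d ih =>
    have hq : Fintype.card F = Fintype.card F - 1 + 1 := by
      have := Fintype.card_pos (α := F); omega
    have h0 : (carlitzE F (d + 1)).eval (RatFunc.X ^ d) = 0 := by
      rw [eval_carlitzE_succ, ih, ← pow_succ, ← hq, sub_self]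
    rw [pow_succ', eval_carlitzE_X_mul, h0, ih, carlitzD]
    ring

/-- By linearity only the new monomial `θ^d` has to be checked, and `e_(d+1)(θ^d) = D_d^q -
D_d^(q-1) D_d = 0`. -/
theorem eval_carlitzE_of_degree_lt (d : ℕ) (a : F[X]) (ha : a.degree < d) :
    (carlitzE F d).eval (algebraMap F[X] (RatFunc F) a) = 0 := by
  have hq : Fintype.card F = Fintype.card F - 1 + 1 := by
    have := Fintype.card_pos (α := F); omega
  induction d generalizing a with
  | zero =>
    have : a = 0 := by simpa [Polynomial.degree_eq_bot] using ha
    simp [this, carlitzE]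
  | succ d ih =>
    have hs (b : F[X]) : (carlitzE F d).eval (algebraMap F[X] (RatFunc F) b) = 0 →
        (carlitzE F (d + 1)).eval (algebraMap F[X] (RatFunc F) b) = 0 := fun h => by
      rw [eval_carlitzE_succ, h, zero_pow Fintype.card_ne_zero]; simp
    obtain ⟨b, hb, hab⟩ : ∃ b : F[X], b.degree < d ∧ a = b + a.coeff d • X ^ d := by
      refine ⟨a - a.coeff d • X ^ d, ?_, by ring⟩
      rw [degree_lt_iff_coeff_zero] at ha ⊢
      intro m hm
      rcases hm.eq_or_lt with rfl | hm
      · simp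
      · simp [coeff_X_pow, ha m (by exact_mod_cast hm), hm.ne']
    rw [hab, map_add, eval_carlitzE_add, hs b (ih b hb), zero_add, Algebra.algebraMap_eq_smul_one,
      smul_assoc, ← Algebra.algebraMap_eq_smul_one, map_pow, RatFunc.algebraMap_X,
      eval_carlitzE_smul, eval_carlitzE_succ, eval_carlitzE_X_pow, ← pow_succ, ← hq, sub_self,
      smul_zero]

theorem eval_carlitzE_monic {d : ℕ} {a : F[X]} (ha : a ∈ monicsOfDegree F d) :
    (carlitzE F d).eval (algebraMap F[X] (RatFunc F) a) = carlitzD F d := by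
  obtain ⟨hm, hd⟩ := (mem_monicsOfDegree F).1 ha
  have h : a.eraseLead.degree < d := by
    rw [← hd, ← degree_eq_natDegree hm.ne_zero]
    exact degree_eraseLead_lt hm.ne_zero
  conv_lhs => rw [← a.eraseLead_add_C_mul_X_pow, hm.leadingCoeff, hd, C_1, one_mul]
  rw [map_add, eval_carlitzE_add, eval_carlitzE_of_degree_lt F d _ h, map_pow,
    RatFunc.algebraMap_X, eval_carlitzE_X_pow, zero_add]

theorem monic_natDegree_carlitzE (d : ℕ) :
    (carlitzE F d).Monic ∧ (carlitzE F d).natDegree = Fintype.card F ^ d := by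
  induction d with
  | zero => simp [carlitzE, monic_X]
  | succ d ih =>
    have hq : 1 < Fintype.card F := Fintype.one_lt_card
    have hp : (carlitzE F d ^ Fintype.card F).Monic := ih.1.pow _
    have hn : (carlitzE F d ^ Fintype.card F).natDegree = Fintype.card F ^ (d + 1) := by
      rw [ih.1.natDegree_pow, ih.2, pow_succ']
    have hlt : (C (carlitzD F d ^ (Fintype.card F - 1)) * carlitzE F d).degree
        < (carlitzE F d ^ Fintype.card F).degree := by
      rw [degree_C_mul (pow_ne_zero _ (carlitzD_ne_zero F d)), degree_eq_natDegree ih.1.ne_zero,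
        degree_eq_natDegree hp.ne_zero, hn, ih.2]
      exact_mod_cast Nat.pow_lt_pow_right hq d.lt_succ_self
    refine ⟨hp.sub_of_left hlt, ?_⟩
    rw [carlitzE, natDegree_sub_eq_left_of_natDegree_lt, hn]
    exact natDegree_lt_natDegree
      (mul_ne_zero (C_ne_zero.2 (pow_ne_zero _ (carlitzD_ne_zero F d))) ih.1.ne_zero) hlt

/-- A `q`-th power has derivative zero, so only the linear term of the recursion survives. Since the
derivative is constant, all Lagrange weights at the monic polynomials coincide. -/
theorem derivative_carlitzE (d : ℕ) :
    derivative (carlitzE F d) = C (carlitzD F d / signedL F d) := by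
  have hq : Fintype.card F = Fintype.card F - 1 + 1 := by
    have := Fintype.card_pos (α := F); omega
  induction d with
  | zero => simp [carlitzE, carlitzD, signedL]
  | succ d ih =>
    have h0 : ((Fintype.card F : ℕ) : (RatFunc F)[X]) = 0 := by
      rw [← map_natCast (algebraMap F (RatFunc F)[X]), FiniteField.cast_card_eq_zero, map_zero]
    rw [carlitzE, derivative_sub, derivative_C_mul, ih, derivative_pow, map_natCast, h0, zero_mul, zero_mul, zero_sub,
      ← C_mul, ← C_neg]
    congr 1
    have h1 := signedL_ne_zero F d
    have h2 := bracket_ne_zero F d.succ_pos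
    rw [carlitzD, signedL]
    have h3 : carlitzD F d ^ Fintype.card F
        = carlitzD F d ^ (Fintype.card F - 1) * carlitzD F d := by rw [← pow_succ, ← hq]
    rw [h3]
    field_simp

/-! ### Lagrange interpolation at the monic polynomials of degree `d` -/

theorem card_monicsOfDegree (d : ℕ) : (monicsOfDegree F d).card = Fintype.card F ^ d := by
  have e : {a // a ∈ monicsOfDegree F d} ≃ (Fin d → F) :=
    ((Equiv.subtypeEquivRight fun a => mem_monicsOfDegree F).trans (monicEquivDegreeLT d)).trans
      (degreeLTEquiv F d).toEquiv
  simpa using Fintype.card_congr e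

/-- Both sides are monic of degree `q^d` and vanish at the `q^d` nodes. -/
theorem nodal_monicsOfDegree (d : ℕ) :
    Lagrange.nodal (monicsOfDegree F d) (algebraMap F[X] (RatFunc F))
      = carlitzE F d - C (carlitzD F d) := by
  obtain ⟨hm, hn⟩ := monic_natDegree_carlitzE F d
  have hpos : 0 < Fintype.card F ^ d := pow_pos Fintype.card_pos _
  have hC : (C (carlitzD F d)).degree < (carlitzE F d).degree := by
    rw [degree_C (carlitzD_ne_zero F d), degree_eq_natDegree hm.ne_zero, hn]
    exact_mod_cast hpos
  have hdeg : (carlitzE F d - C (carlitzD F d)).degree = (Fintype.card F ^ d : ℕ) := by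
    rw [degree_sub_eq_left_of_degree_lt hC, degree_eq_natDegree hm.ne_zero, hn]
  refine eq_of_degree_sub_lt_of_eval_index_eq (s := monicsOfDegree F d)
    (RatFunc.algebraMap_injective F).injOn ?_ fun a ha => ?_
  · have h := Lagrange.degree_nodal (s := monicsOfDegree F d)
      (v := (algebraMap F[X] (RatFunc F) : F[X] → RatFunc F))
    refine (degree_sub_lt_left (h.trans ?_) Lagrange.nodal_ne_zero ?_).trans_eq h
    · rw [hdeg, card_monicsOfDegree]
    · rw [Lagrange.nodal_monic.leadingCoeff, (hm.sub_of_left hC).leadingCoeff]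
  · rw [Lagrange.eval_nodal_at_node ha, eval_sub, eval_C, eval_carlitzE_monic F ha, sub_self]

/-- This is the interpolation formula for `f` evaluated at `0`, where the nodal polynomial is `-D_d`
and every weight is `ℓ_d / D_d`. It is applied to `f = 1` and to `f = X^(q^i)` with `i < d`. -/
theorem sum_eval_div_monicsOfDegree (d : ℕ) (f : (RatFunc F)[X])
    (hf : f.degree < (Fintype.card F ^ d : ℕ)) :
    ∑ a ∈ monicsOfDegree F d, f.eval (algebraMap F[X] (RatFunc F) a) / algebraMap F[X] (RatFunc F) a
      = f.eval 0 / signedL F d := by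
  classical
  have hz : (carlitzE F d).eval 0 = 0 := by
    simpa using eval_carlitzE_smul F d 0 0
  have h := congrArg (eval 0) (Lagrange.eq_interpolate (f := f) (s := monicsOfDegree F d)
    (RatFunc.algebraMap_injective F).injOn (by rwa [card_monicsOfDegree]))
  rw [Lagrange.eval_interpolate_not_at_node, nodal_monicsOfDegree, eval_sub, hz, eval_C] at h
  · have hw (a : F[X]) (ha : a ∈ monicsOfDegree F d) :
        Lagrange.nodalWeight (monicsOfDegree F d) (algebraMap F[X] (RatFunc F)) a
          = signedL F d / carlitzD F d := by
      rw [Lagrange.nodalWeight_eq_eval_derivative_nodal ha, nodal_monicsOfDegree, derivative_sub,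
        derivative_C, sub_zero, derivative_carlitzE, eval_C, inv_div]
    rw [h, Finset.mul_sum, Finset.sum_div]
    refine Finset.sum_congr rfl fun a ha => ?_
    have h1 := signedL_ne_zero F d
    have h2 := carlitzD_ne_zero F d
    rw [hw a ha, zero_sub, zero_sub, inv_neg]
    field_simp
  · intro a ha
    rw [ne_comm, Ne, map_eq_zero_iff _ (RatFunc.algebraMap_injective F)]
    exact ((mem_monicsOfDegree F).1 ha).1.ne_zero

theorem sum_pow_div_monicsOfDegree {d i : ℕ} (hi : i < d) :
    ∑ a ∈ monicsOfDegree F d,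
      algebraMap F[X] (RatFunc F) a ^ Fintype.card F ^ i / algebraMap F[X] (RatFunc F) a = 0 := by
  have h := sum_eval_div_monicsOfDegree F d (X ^ Fintype.card F ^ i) (by
    rw [degree_X_pow]
    exact_mod_cast Nat.pow_lt_pow_right Fintype.one_lt_card hi)
  simpa [Fintype.card_ne_zero] using h

theorem powerSum_one (d : ℕ) : powerSum F d 1 = 1 / signedL F d := by
  have h := sum_eval_div_monicsOfDegree F d 1 (by
    rw [degree_one]
    exact_mod_cast pow_pos Fintype.card_pos _)
  simpa [powerSum] using h

end PowerSums

/-! ### Closed forms for power sums and their partial sums -/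

section ClosedForms

variable (F : Type*) [Field F] [Fintype F]

theorem powerSum_mul_card_pow (d s n : ℕ) :
    powerSum F d (Fintype.card F ^ n * s) = powerSum F d s ^ Fintype.card F ^ n := by
  rw [powerSum, powerSum, ← frob_apply, map_sum]
  refine Finset.sum_congr rfl fun a _ => ?_
  rw [frob_apply, div_pow, one_pow, ← pow_mul, mul_comm]

/-- A generating polynomial in a new variable `t`: it has degree at most `d`, with coefficient
`S_d(1)^(q^j)` at `t^d`. At `t = θ^(q^(i+j))`, `i < d`, it is the `q^j`-th power of `∑ a^(q^i) / a =
0`, which gives all its roots. -/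
theorem sum_map_div_pow_monicsOfDegree (d j : ℕ) :
    ∑ a ∈ monicsOfDegree F d,
        C (1 / algebraMap F[X] (RatFunc F) a ^ Fintype.card F ^ j) * a.map (algebraMap F (RatFunc F))
      = C (1 / signedL F d ^ Fintype.card F ^ j)
        * ∏ i ∈ Finset.range d, (X - C (RatFunc.X ^ Fintype.card F ^ (i + j))) := by
  have hlead : ∑ a ∈ monicsOfDegree F d, 1 / algebraMap F[X] (RatFunc F) a ^ Fintype.card F ^ j
      = 1 / signedL F d ^ Fintype.card F ^ j := by
    have h := powerSum_mul_card_pow F d 1 j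
    rwa [powerSum_one, mul_one, powerSum, div_pow, one_pow] at h
  have hmonic : (∏ i ∈ Finset.range d,
      (X - C ((RatFunc.X : RatFunc F) ^ Fintype.card F ^ (i + j)))).Monic :=
    monic_prod_of_monic _ _ fun i _ => monic_X_sub_C _
  have hnat : (∏ i ∈ Finset.range d,
      (X - C ((RatFunc.X : RatFunc F) ^ Fintype.card F ^ (i + j)))).natDegree = d := by
    rw [natDegree_prod_of_monic _ _ fun i _ => monic_X_sub_C _]
    simp only [natDegree_X_sub_C, Finset.sum_const, Finset.card_range, smul_eq_mul, mul_one]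
  refine eq_of_degree_sub_lt_of_eval_index_eq (s := Finset.range d)
    (v := fun i => (RatFunc.X : RatFunc F) ^ Fintype.card F ^ (i + j))
    (fun a _ b _ h => by simpa using X_pow_card_pow_injective F h) ?_ fun i hi => ?_
  · rw [Finset.card_range, degree_lt_iff_coeff_zero]
    intro m hm
    rw [coeff_sub, finsetSum_coeff, coeff_C_mul, sub_eq_zero]
    rcases hm.eq_or_lt with rfl | hm
    · have h1 := hmonic.coeff_natDegree
      rw [hnat] at h1
      rw [h1, mul_one, ← hlead]
      refine Finset.sum_congr rfl fun a ha => ?_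
      obtain ⟨hm, hd⟩ := (mem_monicsOfDegree F).1 ha
      have h2 : a.coeff d = 1 := by rw [← hd]; exact hm.coeff_natDegree
      rw [coeff_C_mul, coeff_map, h2, map_one, mul_one]
    · rw [coeff_eq_zero_of_natDegree_lt (hnat.trans_lt hm), mul_zero]
      refine Finset.sum_eq_zero fun a ha => ?_
      obtain ⟨-, hd⟩ := (mem_monicsOfDegree F).1 ha
      rw [coeff_C_mul, coeff_map, coeff_eq_zero_of_natDegree_lt (hd.trans_lt hm), map_zero,
        mul_zero]
  · have hprod : eval ((RatFunc.X : RatFunc F) ^ Fintype.card F ^ (i + j))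
        (∏ k ∈ Finset.range d, (X - C ((RatFunc.X : RatFunc F) ^ Fintype.card F ^ (k + j)))) = 0 := by
      rw [eval_prod]
      exact Finset.prod_eq_zero hi (by simp)
    have h := congrArg (frob F (RatFunc F) j) (sum_pow_div_monicsOfDegree F (Finset.mem_range.1 hi))
    rw [map_zero, map_sum] at h
    rw [eval_mul, hprod, mul_zero, eval_finsetSum, ← h]
    refine Finset.sum_congr rfl fun a _ => ?_
    have ha : (a.map (algebraMap F (RatFunc F))).eval (RatFunc.X ^ Fintype.card F ^ (i + j))
        = algebraMap F[X] (RatFunc F) a ^ Fintype.card F ^ (i + j) := by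
      rw [eval_map_algebraMap, ← frob_apply, ← frob_apply, ← RatFunc.algebraMap_X, aeval_algHom_apply,
        aeval_algebraMap_apply, aeval_X_left_apply]
    rw [eval_mul, eval_C, ha, frob_apply, div_pow, ← pow_mul, ← pow_add]
    ring

theorem signedL_add (j d : ℕ) :
    signedL F (j + d) = signedL F j * ∏ i ∈ Finset.range d, (-bracket F (i + (j + 1))) := by
  induction d with
  | zero => simp
  | succ d ih =>
    rw [Finset.prod_range_succ, ← mul_assoc, ← ih, ← add_assoc, signedL,
      show d + (j + 1) = j + d + 1 by ring]
    ring

/-- `S_d(q ^ (j + 1) - 1) = ℓ_{d + j} / (ℓ_j ℓ_d ^ (q ^ (j + 1)))`. -/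
theorem powerSum_card_pow_sub_one (d j : ℕ) :
    powerSum F d (Fintype.card F ^ (j + 1) - 1)
      = signedL F (d + j) / (signedL F j * signedL F d ^ Fintype.card F ^ (j + 1)) := by
  -- At `t = θ` the summand `a(t) / a^(q^(j+1))` becomes `1 / a^(q^(j+1) - 1)`.
  have h := congrArg (eval RatFunc.X) (sum_map_div_pow_monicsOfDegree F d (j + 1))
  rw [eval_mul, eval_prod, eval_C, eval_finsetSum] at h
  have h1 : ∏ i ∈ Finset.range d, eval (RatFunc.X : RatFunc F)
      (X - C (RatFunc.X ^ Fintype.card F ^ (i + (j + 1)))) = signedL F (d + j) / signedL F j := by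
    rw [add_comm d, signedL_add, mul_div_cancel_left₀ _ (signedL_ne_zero F j)]
    refine Finset.prod_congr rfl fun i _ => ?_
    simp [bracket]
  rw [h1] at h
  rw [powerSum, mul_comm (signedL F j), ← div_div, div_right_comm, ← one_div_mul_eq_div, ← h]
  refine Finset.sum_congr rfl fun a ha => ?_
  have h0 : algebraMap F[X] (RatFunc F) a ≠ 0 := by
    rw [Ne, map_eq_zero_iff _ (RatFunc.algebraMap_injective F)]
    exact ((mem_monicsOfDegree F).1 ha).1.ne_zero
  have hpos : 0 < Fintype.card F ^ (j + 1) := pow_pos Fintype.card_pos _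
  rw [eval_mul, eval_C, eval_map_algebraMap, ← RatFunc.algebraMap_X, aeval_algebraMap_apply,
    aeval_X_left_apply, one_div_mul_eq_div, div_eq_div_iff (pow_ne_zero _ h0) (pow_ne_zero _ h0),
    one_mul, ← pow_succ', Nat.sub_add_cancel hpos]

/-- The case `j = 0` of the closed form reads `S_d(q-1) = ℓ_d / ℓ_d^q`; then take `q^n`-th powers.
-/
theorem powerSum_card_sub_one_mul (d n : ℕ) :
    powerSum F d ((Fintype.card F - 1) * Fintype.card F ^ n) * signedL F d ^ Fintype.card F ^ (n + 1)
      = signedL F d ^ Fintype.card F ^ n := by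
  have h := powerSum_card_pow_sub_one F d 0
  have h0 := signedL_ne_zero F d
  rw [zero_add, pow_one, add_zero] at h
  rw [mul_comm _ (_ ^ n), powerSum_mul_card_pow, h, pow_succ', pow_mul, ← mul_pow]
  congr 1
  simp only [signedL]
  field_simp

/-- `∑_{e ≤ d} S_e(q ^ j - 1) = ℓ_{d + j} / (ℓ_j ℓ_d ^ (q ^ j))`. -/
theorem sum_powerSum_card_pow_sub_one (d j : ℕ) :
    ∑ e ∈ Finset.range (d + 1), powerSum F e (Fintype.card F ^ (j + 1) - 1)
      = signedL F (d + (j + 1)) / (signedL F (j + 1) * signedL F d ^ Fintype.card F ^ (j + 1)) := by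
  induction d with
  | zero =>
    rw [zero_add, Finset.sum_range_one, powerSum_card_pow_sub_one, zero_add, zero_add]
    have h1 := signedL_ne_zero F j
    have h2 := signedL_ne_zero F (j + 1)
    simp only [signedL.eq_1, one_pow, mul_one]
    rw [div_self h1, div_self h2]
  | succ d ih =>
    have h1 := signedL_ne_zero F j
    have h2 := bracket_ne_zero F j.succ_pos
    have h3 := signedL_ne_zero F d
    have h4 := bracket_ne_zero F d.succ_pos
    rw [Finset.sum_range_succ, ih, powerSum_card_pow_sub_one]
    have hb := bracket_pow F (d + 1) (j + 1)
    have h5 : bracket F (d + 1) ^ Fintype.card F ^ (j + 1) ≠ 0 := pow_ne_zero _ h4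
    have e1 : signedL F (d + 1 + (j + 1))
        = -bracket F (d + 1 + (j + 1)) * signedL F (d + (j + 1)) := by
      rw [show d + 1 + (j + 1) = d + (j + 1) + 1 by ring, signedL]
    have e2 : signedL F (d + 1) ^ Fintype.card F ^ (j + 1)
        = -bracket F (d + 1) ^ Fintype.card F ^ (j + 1) * signedL F d ^ Fintype.card F ^ (j + 1) := by
      rw [signedL, mul_pow, neg_pow_card_pow]
    rw [e1, e2, show d + 1 + j = d + (j + 1) by ring, signedL.eq_2 F j]
    have h6 : signedL F d ^ Fintype.card F ^ (j + 1) ≠ 0 := pow_ne_zero _ h3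
    generalize signedL F (d + (j + 1)) = A at *
    generalize signedL F d ^ Fintype.card F ^ (j + 1) = B at *
    generalize bracket F (d + 1) ^ Fintype.card F ^ (j + 1) = G at *
    have h7 : bracket F (j + 1) ≠ 0 := h2
    field_simp
    -- With denominators cleared, what remains is `[d+1]^(q^(j+1)) = [d+j+2] - [j+1]`.
    linear_combination -A * hb

/-- `S_d((q - 1) q ^ n) ∑_{e ≤ d} S_e(q ^ n - 1) = S_d(q ^ (n + 1) - 1)`. -/
theorem powerSum_mul_sum_powerSum (d n : ℕ) (hn : 0 < n) :
    powerSum F d ((Fintype.card F - 1) * Fintype.card F ^ n)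
        * ∑ e ∈ Finset.range (d + 1), powerSum F e (Fintype.card F ^ n - 1)
      = powerSum F d (Fintype.card F ^ (n + 1) - 1) := by
  obtain ⟨j, rfl⟩ : ∃ j, n = j + 1 := ⟨n - 1, by omega⟩
  have h := powerSum_card_sub_one_mul F d (j + 1)
  have h1 : signedL F d ^ Fintype.card F ^ (j + 1) ≠ 0 := pow_ne_zero _ (signedL_ne_zero F d)
  have h2 : signedL F d ^ Fintype.card F ^ (j + 1 + 1) ≠ 0 := pow_ne_zero _ (signedL_ne_zero F d)
  have h3 := signedL_ne_zero F (j + 1)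
  rw [sum_powerSum_card_pow_sub_one, powerSum_card_pow_sub_one]
  field_simp
  linear_combination signedL F (d + (j + 1)) * h

end ClosedForms

/-! ### Truncated multizeta values, the collapse to depth one and the recursion -/

section Multizeta

variable (F : Type*) [Field F] [Fintype F]

/-- The truncated multizeta value: the sum of `S_{d_1}(s_1) ⋯ S_{d_r}(s_r)` over all
`d > d_1 > ⋯ > d_r ≥ 0`. -/
def truncZeta : {r : ℕ} → (Fin r → ℕ) → ℕ → RatFunc F
  | 0, _, _ => 1
  | _ + 1, s, d => ∑ e ∈ Finset.range d, powerSum F e (s 0) * truncZeta (Fin.tail s) e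

theorem truncZeta_zero (s : Fin 0 → ℕ) (d : ℕ) : truncZeta F s d = 1 := rfl

theorem truncZeta_succ {r : ℕ} (s : Fin (r + 1) → ℕ) (d : ℕ) :
    truncZeta F s d = ∑ e ∈ Finset.range d, powerSum F e (s 0) * truncZeta F (Fin.tail s) e := rfl

theorem truncZeta_singleton (s d : ℕ) :
    truncZeta F ![s] d = ∑ e ∈ Finset.range d, powerSum F e s := by
  simp [truncZeta]

theorem strictAnti_cons {r : ℕ} (e : ℕ) (x : Fin r → ℕ) :
    StrictAnti (Fin.cons e x : Fin (r + 1) → ℕ) ↔ StrictAnti x ∧ ∀ i, x i < e := by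
  constructor
  · refine fun h => ⟨fun i j hij => ?_, fun i => ?_⟩
    · simpa using h (Fin.succ_lt_succ_iff.2 hij)
    · simpa using h (Fin.succ_pos i)
  · rintro ⟨h1, h2⟩ i j hij
    induction j using Fin.cases with
    | zero => exact absurd hij (Fin.not_lt_zero i)
    | succ j =>
      induction i using Fin.cases with
      | zero => simpa using h2 j
      | succ i => simpa using h1 (Fin.succ_lt_succ_iff.1 hij)

theorem finite_strictAnti_lt (r N : ℕ) :
    {x : Fin r → ℕ | StrictAnti x ∧ ∀ i, x i < N}.Finite :=
  (Set.finite_Iic (fun _ : Fin r => N)).subset fun _ hx i => (hx.2 i).le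

/-- Splitting off the largest index of a decreasing tuple matches the recursion defining
`truncZeta`. -/
theorem algebraMap_truncZeta {r : ℕ} (s : Fin r → ℕ) (N : ℕ) :
    algebraMap (RatFunc F) (KInf F) (truncZeta F s N)
      = ∑ x ∈ (finite_strictAnti_lt r N).toFinset, zetaTerm F s x := by
  induction r generalizing N with
  | zero =>
    have h : (finite_strictAnti_lt 0 N).toFinset = {Fin.elim0} := by
      ext x
      simp only [Set.Finite.mem_toFinset, Set.mem_ofPred_eq, Finset.mem_singleton]
      exact iff_of_true ⟨fun i => i.elim0, fun i => i.elim0⟩ (Subsingleton.elim _ _)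
    rw [h, Finset.sum_singleton, truncZeta_zero, map_one, zetaTerm, Fin.prod_univ_zero]
  | succ r ih =>
    rw [truncZeta_succ, map_sum]
    simp only [map_mul, ih, Finset.mul_sum]
    rw [Finset.sum_sigma']
    refine Finset.sum_bij' (fun x _ => Fin.cons x.1 x.2) (fun x _ => ⟨x 0, Fin.tail x⟩) ?_ ?_
      (fun _ _ => by simp) (fun _ _ => by simp) ?_
    · rintro ⟨e, x⟩ hx
      simp only [Finset.mem_sigma, Finset.mem_range, Set.Finite.mem_toFinset,
        Set.mem_ofPred_eq] at hx ⊢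
      refine ⟨(strictAnti_cons e x).2 hx.2, fun i => ?_⟩
      induction i using Fin.cases with
      | zero => simpa using hx.1
      | succ i => simpa using (hx.2.2 i).trans hx.1
    · intro x hx
      simp only [Finset.mem_sigma, Finset.mem_range, Set.Finite.mem_toFinset,
        Set.mem_ofPred_eq] at hx ⊢
      refine ⟨hx.2 0, (strictAnti_cons _ _).1 ?_⟩
      rw [Fin.cons_self_tail]
      exact hx.1
    · rintro ⟨e, x⟩ _
      simp only [zetaTerm, Fin.prod_univ_succ, Fin.cons_zero, Fin.cons_succ, Fin.tail]

/-- A multizeta value is the limit of its truncations. -/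
theorem tendsto_truncZeta {r : ℕ} (s : Fin r → ℕ) (hs : ∀ i, 0 < s i) :
    Filter.Tendsto (fun N => algebraMap (RatFunc F) (KInf F) (truncZeta F s N)) Filter.atTop
      (nhds (zeta F s)) := by
  classical
  have h := (summable_zetaTerm F s hs).hasSum
  let B (N : ℕ) : Finset {d : Fin r → ℕ // StrictAnti d} :=
    (finite_strictAnti_lt r N).toFinset.subtype StrictAnti
  -- The sum is unconditional, so it may be computed along any exhaustion of the index set by finite
  -- sets.
  have hB : Filter.Tendsto B Filter.atTop Filter.atTop := by
    refine Filter.tendsto_atTop_finset_of_monotone (fun M N hMN x hx => ?_) fun x => ?_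
    · simp only [B, Finset.mem_subtype, Set.Finite.mem_toFinset, Set.mem_ofPred_eq] at hx ⊢
      exact ⟨hx.1, fun i => (hx.2 i).trans_le hMN⟩
    · refine ⟨∑ i, x.1 i + 1, ?_⟩
      simp only [B, Finset.mem_subtype, Set.Finite.mem_toFinset, Set.mem_ofPred_eq]
      exact ⟨x.2, fun i => Nat.lt_succ_of_le
        (Finset.single_le_sum (f := x.1) (by simp) (Finset.mem_univ i))⟩
  refine (Filter.Tendsto.comp h hB).congr fun N => ?_
  rw [algebraMap_truncZeta]
  exact Finset.sum_subtype_of_mem (zetaTerm F s) fun x hx => ((Set.Finite.mem_toFinset _).1 hx).1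

theorem truncZeta_mul_card_pow {r : ℕ} (s : Fin r → ℕ) (n d : ℕ) :
    truncZeta F (fun i => Fintype.card F ^ n * s i) d = truncZeta F s d ^ Fintype.card F ^ n := by
  induction r generalizing d with
  | zero => simp [truncZeta_zero]
  | succ r ih =>
    rw [truncZeta_succ, truncZeta_succ, ← frob_apply, map_sum]
    refine Finset.sum_congr rfl fun e _ => ?_
    rw [frob_apply, mul_pow, ← ih, powerSum_mul_card_pow]
    rfl

theorem tail_eulerianIndex (q n m : ℕ) :
    Fin.tail (eulerianIndex q n (m + 1)) = fun i : Fin m => (q - 1) * q ^ (n + i) := by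
  funext i
  simp [Fin.tail, eulerianIndex]

theorem eulerianIndex_one (q m : ℕ) :
    eulerianIndex q 1 m = fun i : Fin m => (q - 1) * q ^ (i : ℕ) := by
  funext i
  unfold eulerianIndex
  split_ifs with h
  · simp [h]
  · simp

/-- The tail is thus a Frobenius twist of the tuple with `n = 1`, a tuple of the same family with
smaller depth; this permits induction on depth. -/
theorem tail_eulerianIndex_eq_mul (q n m : ℕ) :
    Fin.tail (eulerianIndex q n (m + 1)) = fun i : Fin m => q ^ n * eulerianIndex q 1 m i := by
  rw [tail_eulerianIndex, eulerianIndex_one]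
  funext i
  ring

/-- The coefficient `[k + 1] ⋯ [k + m] / ([1] ^ (q ^ (k + m)) ⋯ [m] ^ (q ^ (k + 1)))`. -/
def eulerianCoeff (k m : ℕ) : RatFunc F :=
  (∏ i ∈ Finset.range m, bracket F (i + (k + 1)))
    / ∏ i ∈ Finset.range m, bracket F (i + 1) ^ Fintype.card F ^ (k + m - i)

theorem signedL_eq_prod (m : ℕ) : signedL F m = ∏ i ∈ Finset.range m, (-bracket F (i + 1)) := by
  simpa [signedL] using signedL_add F 0 m

/-- The shape produced by the induction on depth: the twisted coefficient for the tail times a ratio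
of `ℓ`'s. The signs cancel because this ratio has `m + 1` brackets above and below. -/
theorem eulerianCoeff_succ (k m : ℕ) :
    eulerianCoeff F k (m + 1) = eulerianCoeff F 0 m ^ Fintype.card F ^ (k + 1)
      * (signedL F (k + (m + 1))
        / (signedL F k * signedL F (m + 1) ^ Fintype.card F ^ (k + 1))) := by
  have h0 : ∏ i ∈ Finset.range m, bracket F (i + 1) ^ Fintype.card F ^ (k + 1) ≠ 0 :=
    Finset.prod_ne_zero_iff.2 fun i _ => pow_ne_zero _ (bracket_ne_zero F i.succ_pos)
  have h1 : signedL F (m + 1) ^ Fintype.card F ^ (k + 1)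
      = ∏ i ∈ Finset.range (m + 1), (-bracket F (i + 1) ^ Fintype.card F ^ (k + 1)) := by
    rw [signedL_eq_prod, ← Finset.prod_pow]
    exact Finset.prod_congr rfl fun i _ => neg_pow_card_pow F _ _
  have h2 : signedL F (k + (m + 1)) / (signedL F k * signedL F (m + 1) ^ Fintype.card F ^ (k + 1))
      = (∏ i ∈ Finset.range (m + 1), bracket F (i + (k + 1)))
        / ∏ i ∈ Finset.range (m + 1), bracket F (i + 1) ^ Fintype.card F ^ (k + 1) := by
    rw [signedL_add, h1, mul_div_mul_left _ _ (signedL_ne_zero F k), ← Finset.prod_div_distrib,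
      ← Finset.prod_div_distrib]
    simp only [neg_div_neg_eq]
  have h3 : ∏ i ∈ Finset.range (m + 1), bracket F (i + 1) ^ Fintype.card F ^ (k + (m + 1) - i)
      = (∏ i ∈ Finset.range m, bracket F (i + 1) ^ Fintype.card F ^ (0 + m - i))
          ^ Fintype.card F ^ (k + 1) * bracket F (m + 1) ^ Fintype.card F ^ (k + 1) := by
    rw [Finset.prod_range_succ, ← Finset.prod_pow]
    congr 1
    · refine Finset.prod_congr rfl fun i hi => ?_
      have := Finset.mem_range.1 hi
      rw [← pow_mul, ← pow_add]
      congr 2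
      omega
    · congr 2
      omega
  have h4 : (∏ i ∈ Finset.range m, bracket F (i + (0 + 1))) ^ Fintype.card F ^ (k + 1)
      = ∏ i ∈ Finset.range m, bracket F (i + 1) ^ Fintype.card F ^ (k + 1) := by
    rw [← Finset.prod_pow]
  rw [h2, eulerianCoeff, eulerianCoeff, h3, div_pow, h4,
    Finset.prod_range_succ (fun i => bracket F (i + 1) ^ Fintype.card F ^ (k + 1)), div_mul_div_comm,
    mul_left_comm (_ ^ _), mul_div_mul_left _ _ h0]

theorem sum_range_ite_sub {M : Type*} [AddCommMonoid M] (f : ℕ → M) (m d : ℕ) :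
    ∑ e ∈ Finset.range d, (if m ≤ e then f (e - m) else 0) = ∑ e ∈ Finset.range (d - m), f e := by
  induction d with
  | zero => simp
  | succ d ih =>
    rw [Finset.sum_range_succ, ih]
    split_ifs with h
    · rw [Nat.succ_sub h, Finset.sum_range_succ]
    · rw [add_zero, Nat.sub_eq_zero_of_le (by omega), Nat.sub_eq_zero_of_le (by omega)]

/-- The tail is the `q^(k+1)`-th power of a value with `n = 1`, which by induction is a multiple of
a partial sum of `S_e(q^(m+1) - 1)`. Its closed form has numerator `ℓ_d^(q^(k+1))`, which cancels
the denominator of `S_d(q^(k+1) - 1)`. For `d < m` no decreasing chain of length `m` fits below `d`.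
-/
theorem powerSum_mul_truncZeta_tail (k m d : ℕ) :
    powerSum F d (Fintype.card F ^ (k + 1) - 1)
        * truncZeta F (Fin.tail (eulerianIndex (Fintype.card F) (k + 1) (m + 1))) d
      = if m ≤ d then eulerianCoeff F k m * powerSum F (d - m) (Fintype.card F ^ (k + m + 1) - 1)
        else 0 := by
  induction m generalizing k d with
  | zero => simp [truncZeta_zero, eulerianCoeff]
  | succ m ih =>
    -- The induction hypothesis for `k = 0`, summed over the leading index.
    have h : truncZeta F (eulerianIndex (Fintype.card F) 1 (m + 1)) d
        = eulerianCoeff F 0 m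
          * ∑ e ∈ Finset.range (d - m), powerSum F e (Fintype.card F ^ (m + 1) - 1) := by
      rw [truncZeta_succ, Finset.mul_sum, ← sum_range_ite_sub]
      refine Finset.sum_congr rfl fun e _ => ?_
      simpa [eulerianIndex] using ih 0 e
    rw [tail_eulerianIndex_eq_mul, truncZeta_mul_card_pow, h]
    split_ifs with hd
    · obtain ⟨d, rfl⟩ := Nat.exists_eq_add_of_le' hd
      rw [show d + (m + 1) - m = d + 1 by omega, Nat.add_sub_cancel, sum_powerSum_card_pow_sub_one,
        powerSum_card_pow_sub_one, powerSum_card_pow_sub_one, eulerianCoeff_succ]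
      have h1 := signedL_ne_zero F k
      have h2 := signedL_ne_zero F d
      have h3 := signedL_ne_zero F (m + 1)
      have h4 := signedL_ne_zero F (k + (m + 1))
      have h5 := signedL_ne_zero F (d + (m + 1))
      have h6 : (signedL F d ^ Fintype.card F ^ (m + 1)) ^ Fintype.card F ^ (k + 1)
          = signedL F d ^ Fintype.card F ^ (k + (m + 1) + 1) := by
        rw [← pow_mul, ← pow_add]
        congr 2
        omega
      rw [mul_pow, div_pow, mul_pow, h6, show d + (m + 1) + k = d + (k + (m + 1)) by ring]
      field_simp
    · rw [show d - m = 0 by omega, Finset.sum_range_zero, mul_zero,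
        zero_pow (pow_pos Fintype.card_pos _).ne', mul_zero]

theorem truncZeta_eulerianIndex (k m d : ℕ) :
    truncZeta F (eulerianIndex (Fintype.card F) (k + 1) (m + 1)) d
      = eulerianCoeff F k m * truncZeta F ![Fintype.card F ^ (k + m + 1) - 1] (d - m) := by
  rw [truncZeta_succ, truncZeta_singleton, Finset.mul_sum, ← sum_range_ite_sub]
  refine Finset.sum_congr rfl fun e _ => ?_
  simpa [eulerianIndex] using powerSum_mul_truncZeta_tail F k m e

theorem card_pow_sub_one_pos {n : ℕ} (hn : 0 < n) : 0 < Fintype.card F ^ n - 1 :=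
  Nat.sub_pos_of_lt (Nat.one_lt_pow hn.ne' Fintype.one_lt_card)

theorem eulerianIndex_pos {n : ℕ} (hn : 0 < n) (r : ℕ) (i : Fin r) :
    0 < eulerianIndex (Fintype.card F) n r i := by
  unfold eulerianIndex
  split_ifs
  · exact card_pow_sub_one_pos F hn
  · exact Nat.mul_pos (Nat.sub_pos_of_lt Fintype.one_lt_card) (pow_pos Fintype.card_pos _)

/-- The truncated identity shifts the bound from `d` to `d - m`, which is invisible in the limit. -/
theorem zeta_eulerianIndex (k m : ℕ) :
    zeta F (eulerianIndex (Fintype.card F) (k + 1) (m + 1))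
      = algebraMap (RatFunc F) (KInf F) (eulerianCoeff F k m)
        * zeta F ![Fintype.card F ^ (k + m + 1) - 1] := by
  have h1 := tendsto_truncZeta F _ (eulerianIndex_pos F k.succ_pos (m + 1))
  have h2 := (tendsto_truncZeta F ![Fintype.card F ^ (k + m + 1) - 1]
    (by simpa using card_pow_sub_one_pos F (k + m).succ_pos)).comp (Filter.tendsto_sub_atTop_nat m)
  refine tendsto_nhds_unique h1 ((h2.const_mul _).congr fun d => ?_)
  rw [Function.comp_apply, ← map_mul, ← truncZeta_eulerianIndex]

/-- The square of pairs `(e, f)` is split into `f < e` and `e ≤ f`. -/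
theorem sum_range_mul_sum_range {R : Type*} [CommSemiring R] (a b : ℕ → R) (d : ℕ) :
    (∑ e ∈ Finset.range d, a e) * ∑ e ∈ Finset.range d, b e
      = ∑ e ∈ Finset.range d, a e * ∑ f ∈ Finset.range e, b f
        + ∑ f ∈ Finset.range d, b f * ∑ e ∈ Finset.range (f + 1), a e := by
  induction d with
  | zero => simp
  | succ d ih =>
    rw [Finset.sum_range_succ a, Finset.sum_range_succ b, add_mul, mul_add, mul_add, ih,
      Finset.sum_range_succ, Finset.sum_range_succ _ d, Finset.sum_range_succ a]
    ring

/-- In the part `e ≤ f`, `powerSum_mul_sum_powerSum` fuses `S_f((q-1)q^n)` with the inner sum over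
`e` into `S_f(q^(n+1) - 1)`. -/
theorem truncZeta_mul_truncZeta {n : ℕ} (hn : 0 < n) (m d : ℕ) :
    truncZeta F ![Fintype.card F ^ n - 1] d
        * truncZeta F (fun i : Fin (m + 1) => (Fintype.card F - 1) * Fintype.card F ^ (i : ℕ)) d
          ^ Fintype.card F ^ n
      = truncZeta F (eulerianIndex (Fintype.card F) n (m + 2)) d
        + truncZeta F (eulerianIndex (Fintype.card F) (n + 1) (m + 1)) d := by
  have hs : Fin.tail (eulerianIndex (Fintype.card F) n (m + 2)) = fun i : Fin (m + 1) =>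
      Fintype.card F ^ n * ((Fintype.card F - 1) * Fintype.card F ^ (i : ℕ)) := by
    rw [tail_eulerianIndex_eq_mul, eulerianIndex_one]
  rw [← truncZeta_mul_card_pow, ← hs,
    truncZeta_singleton,
    truncZeta_succ F (r := m) (Fin.tail (eulerianIndex _ n (m + 2))), sum_range_mul_sum_range,
    truncZeta_succ, truncZeta_succ F (eulerianIndex _ (n + 1) _)]
  congr 1
  refine Finset.sum_congr rfl fun e _ => ?_
  have h : Fin.tail (Fin.tail (eulerianIndex (Fintype.card F) n (m + 2)))
      = Fin.tail (eulerianIndex (Fintype.card F) (n + 1) (m + 1)) := by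
    rw [tail_eulerianIndex, tail_eulerianIndex]
    funext i
    simp only [Fin.tail, Fin.val_succ]
    congr 2
    ring
  rw [h, mul_right_comm, tail_eulerianIndex]
  congr 1
  simpa [eulerianIndex] using powerSum_mul_sum_powerSum F e n hn

theorem zeta_eulerianIndex_recursion {n : ℕ} (hn : 0 < n) (m : ℕ) :
    zeta F (eulerianIndex (Fintype.card F) n (m + 2))
      = zeta F ![Fintype.card F ^ n - 1]
          * zeta F (fun i : Fin (m + 1) => (Fintype.card F - 1) * Fintype.card F ^ (i : ℕ))
            ^ Fintype.card F ^ n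
        - zeta F (eulerianIndex (Fintype.card F) (n + 1) (m + 1)) := by
  have h1 := tendsto_truncZeta F _ (eulerianIndex_pos F hn (m + 2))
  have h2 := tendsto_truncZeta F ![Fintype.card F ^ n - 1]
    (by simpa using card_pow_sub_one_pos F hn)
  have h3 := tendsto_truncZeta F
    (fun i : Fin (m + 1) => (Fintype.card F - 1) * Fintype.card F ^ (i : ℕ))
    (fun i => by simpa [eulerianIndex_one] using eulerianIndex_pos F one_pos (m + 1) i)
  have h4 := tendsto_truncZeta F _ (eulerianIndex_pos F n.succ_pos (m + 1))
  refine tendsto_nhds_unique h1 (((h2.mul (h3.pow (Fintype.card F ^ n))).sub h4).congr fun d => ?_)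
  rw [← map_pow, ← map_mul, ← map_sub, truncZeta_mul_truncZeta F hn, add_sub_cancel_right]

end Multizeta

/-! ### Carlitz zeta values and the period -/

section PeriodEvaluation

variable (F : Type*) [Field F] [Fintype F]

theorem norm_periodFactor (i : ℕ) : ‖periodFactor F (i + 1)‖ = 1 := by
  have hq : (1 : ℝ) < Fintype.card F := by exact_mod_cast Fintype.one_lt_card
  have hq2 : 1 < Fintype.card F := Fintype.one_lt_card
  have hθ : ‖algebraMap (RatFunc F) (KInf F) RatFunc.X‖ = Fintype.card F := by
    rw [← RatFunc.algebraMap_X, norm_polynomial F Polynomial.X_ne_zero]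
    simp
  have hlt : ‖algebraMap (RatFunc F) (KInf F) (RatFunc.X / RatFunc.X ^ Fintype.card F ^ (i + 1))‖
      < 1 := by
    rw [map_div₀, map_pow, norm_div, norm_pow, hθ, div_lt_one (by positivity)]
    exact lt_self_pow₀ hq (Nat.one_lt_pow i.succ_ne_zero hq2)
  have h := IsUltrametricDist.norm_add_eq_max_of_norm_ne_norm (x := (1 : KInf F))
    (y := -algebraMap (RatFunc F) (KInf F) (RatFunc.X / RatFunc.X ^ Fintype.card F ^ (i + 1)))
    (by rw [norm_neg, norm_one]; exact hlt.ne')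
  rw [periodFactor, map_inv₀, map_sub, map_one, norm_inv, sub_eq_add_neg, h, norm_neg, norm_one,
    max_eq_left hlt.le, inv_one]

theorem tendsto_prod_periodFactor :
    Filter.Tendsto (fun d => ∏ i ∈ Finset.range d, periodFactor F (i + 1)) Filter.atTop
      (nhds (periodProduct F)) :=
  (multipliable_periodFactor F).hasProd.tendsto_prod_nat

theorem periodProduct_ne_zero : periodProduct F ≠ 0 := by
  have h := (tendsto_prod_periodFactor F).norm
  simp only [norm_prod, norm_periodFactor, Finset.prod_const_one] at h
  rw [← norm_ne_zero_iff, tendsto_nhds_unique h tendsto_const_nhds]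
  exact one_ne_zero

/-- Factor by factor, `-[i+1]` equals `(-θ)^(q^(i+1)) (1 - θ/θ^(q^(i+1)))`. -/
theorem algebraMap_signedL_mul_prod (d : ℕ) :
    algebraMap (RatFunc F) (KInf F) (signedL F d) * ∏ i ∈ Finset.range d, periodFactor F (i + 1)
      = algebraMap (RatFunc F) (KInf F)
        (∏ i ∈ Finset.range d, (-RatFunc.X) ^ Fintype.card F ^ (i + 1)) := by
  rw [signedL_eq_prod, map_prod, map_prod, ← Finset.prod_mul_distrib]
  refine Finset.prod_congr rfl fun i _ => ?_
  have h0 : (RatFunc.X : RatFunc F) ^ Fintype.card F ^ (i + 1) ≠ 0 := pow_ne_zero _ RatFunc.X_ne_zero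
  have h1 : (RatFunc.X : RatFunc F) ^ Fintype.card F ^ (i + 1) - RatFunc.X ≠ 0 :=
    bracket_ne_zero F i.succ_pos
  rw [periodFactor, ← map_mul, bracket, neg_pow_card_pow, one_sub_div h0, inv_div]
  congr 1
  field_simp

/-- The Carlitz zeta value `ζ_A(q ^ k - 1)`, in terms of the product for the period. -/
theorem zeta_card_pow_sub_one {k : ℕ} (hk : 0 < k) :
    algebraMap (RatFunc F) (KInf F) (signedL F k) * zeta F ![Fintype.card F ^ k - 1]
      = algebraMap (RatFunc F) (KInf F)
          (∏ i ∈ Finset.range k, (-RatFunc.X) ^ Fintype.card F ^ (i + 1))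
        * periodProduct F ^ (Fintype.card F ^ k - 1) := by
  obtain ⟨j, rfl⟩ : ∃ j, k = j + 1 := ⟨k - 1, by omega⟩
  have hP := periodProduct_ne_zero F
  have h1 := (tendsto_truncZeta F ![Fintype.card F ^ (j + 1) - 1]
    (by simpa using card_pow_sub_one_pos F j.succ_pos)).comp (Filter.tendsto_add_atTop_nat 1)
  have h2 := tendsto_prod_periodFactor F
  have h3 := h2.comp (Filter.tendsto_add_atTop_nat (j + 1))
  -- The closed form of the partial sum with each `ℓ` replaced by its product; the powers of `-θ`
  -- depending on `d` cancel, so both sides converge.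
  have key (d : ℕ) : algebraMap (RatFunc F) (KInf F) (signedL F (j + 1))
        * algebraMap (RatFunc F) (KInf F) (truncZeta F ![Fintype.card F ^ (j + 1) - 1] (d + 1))
        * ∏ i ∈ Finset.range (d + (j + 1)), periodFactor F (i + 1)
      = algebraMap (RatFunc F) (KInf F)
          (∏ i ∈ Finset.range (j + 1), (-RatFunc.X) ^ Fintype.card F ^ (i + 1))
        * (∏ i ∈ Finset.range d, periodFactor F (i + 1)) ^ Fintype.card F ^ (j + 1) := by
    have hd0 : algebraMap (RatFunc F) (KInf F) (signedL F d ^ Fintype.card F ^ (j + 1)) ≠ 0 := by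
      rw [Ne, map_eq_zero]
      exact pow_ne_zero _ (signedL_ne_zero F d)
    have hs : signedL F (j + 1) * truncZeta F ![Fintype.card F ^ (j + 1) - 1] (d + 1)
        * signedL F d ^ Fintype.card F ^ (j + 1) = signedL F (d + (j + 1)) := by
      rw [truncZeta_singleton, sum_powerSum_card_pow_sub_one]
      have h1 := signedL_ne_zero F (j + 1)
      have h2 := signedL_ne_zero F d
      field_simp
    have hX : ∏ i ∈ Finset.range (d + (j + 1)), (-RatFunc.X : RatFunc F) ^ Fintype.card F ^ (i + 1)
        = (∏ i ∈ Finset.range (j + 1), (-RatFunc.X) ^ Fintype.card F ^ (i + 1))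
          * (∏ i ∈ Finset.range d, (-RatFunc.X) ^ Fintype.card F ^ (i + 1))
            ^ Fintype.card F ^ (j + 1) := by
      rw [add_comm d, Finset.prod_range_add, ← Finset.prod_pow]
      congr 1
      refine Finset.prod_congr rfl fun i _ => ?_
      rw [← pow_mul, ← pow_add]
      congr 2
      ring
    refine mul_right_cancel₀ hd0 ?_
    rw [← map_mul, mul_right_comm, ← map_mul, hs, algebraMap_signedL_mul_prod, hX, map_mul, map_pow,
      ← algebraMap_signedL_mul_prod F d, map_pow]
    ring
  have h4 := tendsto_nhds_unique (((h1.const_mul _).mul h3).congr key)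
    ((h2.pow (Fintype.card F ^ (j + 1))).const_mul _)
  -- The limit carries one period product on the left and its `q^(j+1)`-th power on the right;
  -- cancelling one gives the exponent `q^(j+1) - 1`.
  refine mul_right_cancel₀ hP ?_
  rw [h4, mul_assoc, ← pow_succ, Nat.sub_add_cancel (pow_pos Fintype.card_pos _)]

/-- Telescoping of exponents: `(q-1)(q + ⋯ + q^k) + q = q^(k+1)`. For `x = ρ` it shows that
`ρ^(q(q^k - 1))` lies in `K` and is independent of the root chosen. -/
theorem prod_pow_mul_pow {R : Type*} [CommMonoid R] (x : R) {q : ℕ} (hq : 0 < q) (k : ℕ) :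
    (∏ i ∈ Finset.range k, (x ^ (q - 1)) ^ q ^ (i + 1)) * x ^ q = x ^ q ^ (k + 1) := by
  induction k with
  | zero => simp
  | succ k ih =>
    rw [Finset.prod_range_succ, mul_right_comm, ih, ← pow_mul, ← pow_add]
    congr 1
    obtain ⟨p, rfl⟩ : ∃ p, q = p + 1 := ⟨q - 1, by omega⟩
    rw [Nat.add_sub_cancel]
    ring

theorem carlitzPeriod_pow (ρ : CInf F) (hρ : ρ ^ (Fintype.card F - 1) = -toCInf F RatFunc.X)
    (k : ℕ) :
    carlitzPeriod F ρ ^ (Fintype.card F ^ k - 1)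
      = toCInf F (∏ i ∈ Finset.range k, (-RatFunc.X) ^ Fintype.card F ^ (i + 1))
        * algebraMap (KInf F) (CInf F) (periodProduct F) ^ (Fintype.card F ^ k - 1) := by
  have h0 : ρ ≠ 0 := by
    rintro rfl
    have hq : Fintype.card F - 1 ≠ 0 := (Nat.sub_pos_of_lt Fintype.one_lt_card).ne'
    rw [zero_pow hq, zero_eq_neg, map_eq_zero] at hρ
    exact RatFunc.X_ne_zero hρ
  rw [carlitzPeriod, mul_pow]
  congr 1
  refine mul_right_cancel₀ (pow_ne_zero (Fintype.card F) h0) ?_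
  rw [map_prod]
  simp only [map_pow, map_neg]
  rw [← hρ, prod_pow_mul_pow ρ Fintype.card_pos, ← pow_succ,
    Nat.sub_add_cancel (pow_pos Fintype.card_pos _), ← pow_mul, pow_succ']

/-- Carlitz: `ζ_A(q ^ k - 1) = π̃ ^ (q ^ k - 1) / ℓ_k`. -/
theorem zeta_card_pow_sub_one_eq_period (ρ : CInf F)
    (hρ : ρ ^ (Fintype.card F - 1) = -toCInf F RatFunc.X) {k : ℕ} (hk : 0 < k) :
    algebraMap (KInf F) (CInf F) (zeta F ![Fintype.card F ^ k - 1])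
      = toCInf F (signedL F k)⁻¹ * carlitzPeriod F ρ ^ (Fintype.card F ^ k - 1) := by
  have h := congrArg (algebraMap (KInf F) (CInf F)) (zeta_card_pow_sub_one F hk)
  have h0 : toCInf F (signedL F k) ≠ 0 := by
    rw [Ne, map_eq_zero]
    exact signedL_ne_zero F k
  rw [carlitzPeriod_pow F ρ hρ, map_inv₀, eq_inv_mul_iff_mul_eq₀ h0]
  rw [map_mul, map_mul, map_pow] at h
  exact h

/-- The sum telescopes; it identifies the exponent of the period with the weight. -/
theorem sum_eulerianIndex {q : ℕ} (hq : 0 < q) (n m : ℕ) :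
    ∑ i, eulerianIndex q n (m + 1) i = q ^ (n + m) - 1 := by
  have h1 (m : ℕ) : ∑ i ∈ Finset.range m, (q - 1) * q ^ (n + i) + q ^ n = q ^ (n + m) := by
    induction m with
    | zero => simp
    | succ m ih =>
      rw [Finset.sum_range_succ, add_right_comm, ih]
      obtain ⟨p, rfl⟩ : ∃ p, q = p + 1 := ⟨q - 1, by omega⟩
      rw [Nat.add_sub_cancel]
      ring
  have h2 : ∑ i : Fin m, eulerianIndex q n (m + 1) i.succ
      = ∑ i ∈ Finset.range m, (q - 1) * q ^ (n + i) := by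
    rw [← Fin.sum_univ_eq_sum_range]
    exact Finset.sum_congr rfl fun i _ => congrFun (tail_eulerianIndex q n m) i
  have h3 : 0 < q ^ n := pow_pos hq n
  rw [Fin.sum_univ_succ, h2, ← h1 m]
  simp only [eulerianIndex, Fin.val_zero, if_true]
  omega

theorem eulerianCoeff_eq (n m : ℕ) :
    (∏ j ∈ Finset.Icc (n + 1) (n + m), bracket F j)
      / (∏ j ∈ Finset.Icc 1 m, bracket F j ^ Fintype.card F ^ (n + 1 + m - j))
      = eulerianCoeff F n m := by
  have h (a b : ℕ) : Finset.Icc a b = Finset.Ico a (b + 1) := by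
    ext
    simp only [Finset.mem_Icc, Finset.mem_Ico]
    omega
  rw [eulerianCoeff, h, h, Finset.prod_Ico_eq_prod_range, Finset.prod_Ico_eq_prod_range,
    show n + m + 1 - (n + 1) = m by omega, Nat.add_sub_cancel]
  congr 1
  · exact Finset.prod_congr rfl fun i _ => by rw [add_comm]
  · refine Finset.prod_congr rfl fun i _ => ?_
    rw [add_comm 1 i, show n + 1 + m - (i + 1) = n + m - i by omega]

end PeriodEvaluation

end CarlitzMZV

end

theorem theorem5p1 (F : Type*) [Field F] [Fintype F] (q n r : ℕ) (hq : Fintype.card F = q)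
    (hr : 1 < r) (hn : 0 < n) :
    -- the recursion
    CarlitzMZV.zeta F (CarlitzMZV.eulerianIndex q n r) =
        CarlitzMZV.zeta F ![q ^ n - 1] *
            CarlitzMZV.zeta F (fun i : Fin (r - 1) => (q - 1) * q ^ (i : ℕ)) ^ q ^ n
          - CarlitzMZV.zeta F (CarlitzMZV.eulerianIndex q (n + 1) (r - 1)) ∧
    -- the value in terms of the Carlitz period
    (∀ ρ : CarlitzMZV.CInf F, ρ ^ (q - 1) = -CarlitzMZV.toCInf F RatFunc.X →
      algebraMap (CarlitzMZV.KInf F) (CarlitzMZV.CInf F)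
          (CarlitzMZV.zeta F (CarlitzMZV.eulerianIndex q n r)) =
        CarlitzMZV.toCInf F
            ((-1) ^ (n + r - 1) * (∏ j ∈ Finset.Icc n (n + r - 2), CarlitzMZV.bracket F j) /
              ((∏ j ∈ Finset.Icc 1 (r - 1), CarlitzMZV.bracket F j ^ q ^ (n + r - 1 - j)) *
                CarlitzMZV.carlitzL F (n + r - 1))) *
          CarlitzMZV.carlitzPeriod F ρ ^ (q ^ (n + r - 1) - 1) ∧
      CarlitzMZV.IsEulerian F (CarlitzMZV.carlitzPeriod F ρ)
        (CarlitzMZV.eulerianIndex q n r)) ∧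
    -- the value in terms of a Carlitz zeta value
    CarlitzMZV.zeta F (CarlitzMZV.eulerianIndex q n r) =
      algebraMap (RatFunc F) (CarlitzMZV.KInf F)
          ((∏ j ∈ Finset.Icc n (n + r - 2), CarlitzMZV.bracket F j) /
            (∏ j ∈ Finset.Icc 1 (r - 1), CarlitzMZV.bracket F j ^ q ^ (n + r - 1 - j))) *
        CarlitzMZV.zeta F ![q ^ (n + r - 1) - 1] := by
  subst hq
  obtain ⟨m, rfl⟩ : ∃ m, r = m + 2 := ⟨r - 2, by omega⟩
  obtain ⟨k, rfl⟩ : ∃ k, n = k + 1 := ⟨n - 1, by omega⟩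
  have hc := CarlitzMZV.eulerianCoeff_eq F k (m + 1)
  have hz := CarlitzMZV.zeta_eulerianIndex F k (m + 1)
  have e1 : k + 1 + (m + 2) - 2 = k + (m + 1) := by omega
  have e2 : k + 1 + (m + 2) - 1 = k + 1 + (m + 1) := by omega
  have e4 : k + (m + 1) + 1 = k + 1 + (m + 1) := by omega
  rw [e4] at hz
  rw [e1, e2]
  have hπ : ∀ ρ : CarlitzMZV.CInf F, ρ ^ (Fintype.card F - 1) = -CarlitzMZV.toCInf F RatFunc.X →
      algebraMap (CarlitzMZV.KInf F) (CarlitzMZV.CInf F)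
          (CarlitzMZV.zeta F (CarlitzMZV.eulerianIndex (Fintype.card F) (k + 1) (m + 2))) =
        CarlitzMZV.toCInf F
            ((-1) ^ (k + 1 + (m + 1)) *
                (∏ j ∈ Finset.Icc (k + 1) (k + (m + 1)), CarlitzMZV.bracket F j) /
              ((∏ j ∈ Finset.Icc 1 (m + 1),
                  CarlitzMZV.bracket F j ^ Fintype.card F ^ (k + 1 + (m + 1) - j)) *
                CarlitzMZV.carlitzL F (k + 1 + (m + 1)))) *
          CarlitzMZV.carlitzPeriod F ρ ^ (Fintype.card F ^ (k + 1 + (m + 1)) - 1) := by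
    intro ρ hρ
    have h1 : (-1 : RatFunc F) ^ (k + 1 + (m + 1))
        * (∏ j ∈ Finset.Icc (k + 1) (k + (m + 1)), CarlitzMZV.bracket F j)
        / ((∏ j ∈ Finset.Icc 1 (m + 1),
            CarlitzMZV.bracket F j ^ Fintype.card F ^ (k + 1 + (m + 1) - j))
          * CarlitzMZV.carlitzL F (k + 1 + (m + 1)))
        = CarlitzMZV.eulerianCoeff F k (m + 1)
          * (CarlitzMZV.signedL F (k + 1 + (m + 1)))⁻¹ := by
      -- The sign between `ℓ` and `L` is its own inverse, so it moves to the numerator.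
      have h2 : ((-1 : RatFunc F) ^ (k + 1 + (m + 1)))⁻¹ = (-1) ^ (k + 1 + (m + 1)) := by
        rw [← inv_pow, inv_neg_one]
      rw [← hc, CarlitzMZV.signedL_eq, mul_inv, h2]
      ring
    rw [hz, map_mul, h1, map_mul,
      CarlitzMZV.zeta_card_pow_sub_one_eq_period F ρ hρ (show 0 < k + 1 + (m + 1) by omega), ← mul_assoc]
    rfl
  refine ⟨CarlitzMZV.zeta_eulerianIndex_recursion F k.succ_pos m, fun ρ hρ => ⟨hπ ρ hρ, ?_⟩, ?_⟩
  · have h := hπ ρ hρ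
    rw [← CarlitzMZV.sum_eulerianIndex Fintype.card_pos (k + 1) (m + 1)] at h
    exact ⟨_, h⟩
  · rw [hz, ← hc]
    rfl
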